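/- All graphs are finite. An interval graph is the intersection graph of a family of open intervals of the real line. The claw number of a graph $G$ is the largest integer $v\ge 0$ such that the star $K_{1,v}$ is an induced subgraph of $G$. For integers $w\ge v\ge 1$, let $\check\kappa(w,v)$ be the smallest number $k$ such that every interval graph with claw number at most $w$ admits a partition of its vertices into $k$ (possibly empty) classes, each of which induces a subgraph with claw number at most $v$. Then $$\check\kappa(2,1)=2,\quad \check\kappa(3,1)=3,\quad \check\kappa(3,2)=2,\quad \check\kappa(4,2)=\check\kappa(5,2)=\check\kappa(6,2)=3,\quad \check\kappa(5,3)=2.$$ -/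

import Mathlib

/-- The claw number of a graph: the largest `v` such that the star `K_{1,v}` is an induced
subgraph. It is a supremum in `ℕ∞`, so it is `⊤` if induced stars are arbitrarily large (which
does not happen for finite graphs) and `0` for the graph without vertices. -/
noncomputable def clawNumber {V : Type*} (G : SimpleGraph V) : ℕ∞ :=
  ⨆ (v : ℕ) (_ : (completeBipartiteGraph (Fin 1) (Fin v)).IsIndContained G), (v : ℕ∞)

/-- A graph is an interval graph if it is the intersection graph of a family of nonempty open
intervals of the real line, one interval for each vertex. -/
def IsIntervalGraph {V : Type*} (G : SimpleGraph V) : Prop :=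
  ∃ l r : V → ℝ, (∀ x, l x < r x) ∧
    ∀ x y, G.Adj x y ↔ x ≠ y ∧ (Set.Ioo (l x) (r x) ∩ Set.Ioo (l y) (r y)).Nonempty

/-- The vertices of `G` can be partitioned into `k` classes (the fibres of `c`, possibly empty)
such that each class induces a subgraph with claw number at most `v`. -/
def HasClawPartition {V : Type*} (G : SimpleGraph V) (k v : ℕ) : Prop :=
  ∃ c : V → Fin k, ∀ i : Fin k, clawNumber (G.induce {x | c x = i}) ≤ v

/-- `IsKappaCheck w v k`: the number `k` is the smallest one such that every finite interval graph
with claw number at most `w` has a vertex partition into `k` induced subgraphs with claw number at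
most `v`. -/
def IsKappaCheck (w v k : ℕ) : Prop :=
  IsLeast {m : ℕ | ∀ (V : Type) [Finite V] (G : SimpleGraph V),
    IsIntervalGraph G → clawNumber G ≤ w → HasClawPartition G m v} k

/-! For the upper bounds, let `packing t` be the largest number of disjoint intervals in `(-∞, t]`,
and attach to an interval `x` the numbers `a < b` that `packing` takes at its two end points. If the
claw number is at most `w`, then `b ≤ a + w`, and the first number `a'` of any interval meeting `x`
satisfies `a' < a + w`; moreover disjointness and overlap of intervals give the obvious inequalities
between their numbers. So `x` may be replaced by the set of integers `{a, …, b - 1}`, and it is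
enough to find a colouring of these sets that excludes monochromatic claws
(`hasClawPartition_of_coloring`). Periodic colourings work: `a` modulo `k` for `v = 1`, blocks of
two consecutive values of `a` for `(w, v) = (3, 2)`, and a distinction by multiples of `4`, or of
`3` and `9`, in `{a, …, b - 1}` for `(5, 3)` and `(6, 2)`. The verifications are linear arithmetic.

For the lower bounds, consider intervals with integer end points and lengths between `s` and
`u * s + 1`. Their intersection graph has claw number at most `u + 1`: of `u + 2` disjoint intervals
meeting a given one, `u` lie inside it and the outer two overlap it, which requires length
`u * s + 2` (`clawNumber_natIntervalGraph_le`). Nine such intervals with `s = 1`, `u = 2` admit no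
partition into two classes of claw number at most `1`, and thirty-nine intervals with `s = 2`,
`u = 3` admit none into two classes of claw number at most `2`. Both facts are established by a
backtracking search over 2-colourings, whose correctness is `exists_mono_of_refuted` and which is
evaluated by the kernel. The bounds that only exclude a single class come from stars. -/

/-! ### Claws in interval graphs -/

/-- `IsIntervalRep G l r` says that `G` is the intersection graph of the nonempty open intervals
`(l x, r x)`, with intersection expressed by inequalities between the end points. -/
def IsIntervalRep {V : Type*} (G : SimpleGraph V) (l r : V → ℝ) : Prop :=
  (∀ x, l x < r x) ∧ ∀ x y, G.Adj x y ↔ x ≠ y ∧ l x < r y ∧ l y < r x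

theorem Ioo_inter_nonempty_iff {a b c d : ℝ} (hab : a < b) (hcd : c < d) :
    (Set.Ioo a b ∩ Set.Ioo c d).Nonempty ↔ a < d ∧ c < b := by
  rw [Set.Ioo_inter_Ioo, Set.nonempty_Ioo, max_lt_iff, lt_min_iff, lt_min_iff]
  tauto

theorem isIntervalGraph_iff {V : Type*} {G : SimpleGraph V} :
    IsIntervalGraph G ↔ ∃ l r, IsIntervalRep G l r := by
  refine exists_congr fun l => exists_congr fun r => and_congr_right fun h => ?_
  simp only [Ioo_inter_nonempty_iff (h _) (h _)]

theorem IsIntervalRep.induce {V : Type*} {G : SimpleGraph V} {l r : V → ℝ}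
    (h : IsIntervalRep G l r) (s : Set V) :
    IsIntervalRep (G.induce s) (fun x => l x) (fun x => r x) :=
  ⟨fun x => h.1 x, fun x y => by simp [h.2, Subtype.ext_iff]⟩

theorem clawNumber_le_iff {V : Type*} {G : SimpleGraph V} {v : ℕ} :
    clawNumber G ≤ v ↔ ∀ (x : V) (f : Fin (v + 1) → V), Function.Injective f →
      (∀ i, G.Adj x (f i)) → ∃ i j, G.Adj (f i) (f j) := by
  constructor
  · intro h x f hf hx
    by_contra! hn
    have hemb : (completeBipartiteGraph (Fin 1) (Fin (v + 1))).IsIndContained G := by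
      refine ⟨⟨⟨Sum.elim (fun _ => x) f, ?_⟩, ?_⟩⟩
      · rintro (a | a) (b | b) hab
        · rw [Subsingleton.elim a b]
        · exact absurd (hx b) (by simp_all)
        · exact absurd (hx a) (by simp_all)
        · rw [hf hab]
      · intro a b
        change G.Adj (Sum.elim (fun _ => x) f a) (Sum.elim (fun _ => x) f b) ↔ _
        obtain a | a := a <;> obtain b | b := b
        · simp
        · simpa using hx b
        · simpa using (hx a).symm
        · simpa using hn a b
    have h2 : ((v + 1 : ℕ) : ℕ∞) ≤ v :=
      (le_iSup₂ (f := fun (v : ℕ)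
        (_ : (completeBipartiteGraph (Fin 1) (Fin v)).IsIndContained G) => (v : ℕ∞))
        (v + 1) hemb).trans h
    have h3 : v + 1 ≤ v := by exact_mod_cast h2
    omega
  · intro h
    refine iSup₂_le fun u ⟨e⟩ => ?_
    by_contra hu
    have hvu : v + 1 ≤ u := by
      have : v < u := by simpa using hu
      omega
    obtain ⟨i, j, hij⟩ := h (e (Sum.inl 0)) (fun i => e (Sum.inr (Fin.castLE hvu i)))
      (fun i j hij => by simpa using hij) (fun i => e.map_rel_iff.2 (by simp))
    have := e.map_rel_iff.1 hij
    simp at this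

/-- `IsClaw l r x f`: the intervals `f 0, …, f (n - 1)` all meet the interval `x`, and each of them
lies to the left of the following ones. -/
def IsClaw {V : Type*} (l r : V → ℝ) (x : V) {n : ℕ} (f : Fin n → V) : Prop :=
  (∀ i, l x < r (f i) ∧ l (f i) < r x) ∧ ∀ i j, i < j → r (f i) ≤ l (f j)

theorem exists_isClaw_of_disjoint {V : Type*} {l r : V → ℝ} (hlr : ∀ x, l x < r x) {x : V} {n : ℕ}
    (f : Fin n → V) (hx : ∀ i, l x < r (f i) ∧ l (f i) < r x)
    (hf : ∀ i j, i ≠ j → r (f i) ≤ l (f j) ∨ r (f j) ≤ l (f i)) :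
    ∃ σ : Equiv.Perm (Fin n), IsClaw l r x (f ∘ σ) := by
  refine ⟨Tuple.sort (l ∘ f), fun i => hx _, fun i j hij => ?_⟩
  have hm : l (f (Tuple.sort (l ∘ f) i)) ≤ l (f (Tuple.sort (l ∘ f) j)) :=
    Tuple.monotone_sort (l ∘ f) hij.le
  rcases hf (Tuple.sort (l ∘ f) i) (Tuple.sort (l ∘ f) j) (by simpa using hij.ne) with h | h
  · exact h
  · have := hlr (f (Tuple.sort (l ∘ f) j))
    linarith

/-- In an interval graph, claw number at most `v` means that no interval meets `v + 1` pairwise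
disjoint ones. For `v = 0` this fails: a single interval meets itself without being a leaf. -/
theorem IsIntervalRep.clawNumber_le_iff {V : Type*} {G : SimpleGraph V} {l r : V → ℝ}
    (h : IsIntervalRep G l r) {v : ℕ} (hv : 1 ≤ v) :
    clawNumber G ≤ v ↔ ∀ (x : V) (f : Fin (v + 1) → V), ¬ IsClaw l r x f := by
  rw [_root_.clawNumber_le_iff]
  constructor
  · rintro H x f ⟨hx, hf⟩
    have hne : ∀ i j, i ≠ j → r (f i) ≤ l (f j) ∨ r (f j) ≤ l (f i) := fun i j hij =>
      (lt_or_gt_of_ne hij).imp (hf i j) (hf j i)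
    have hinj : Function.Injective f := fun i j hij => by
      by_contra hc
      have := h.1 (f j)
      rcases hne i j hc with h1 | h1 <;> rw [hij] at h1 <;> linarith
    have hxf : ∀ i, x ≠ f i := by
      intro i hi
      have : Nontrivial (Fin (v + 1)) := Fin.nontrivial_iff_two_le.2 (by omega)
      obtain ⟨j, hj⟩ := exists_ne i
      have h1 := hx j
      rw [hi] at h1
      rcases hne i j hj.symm with h2 | h2 <;> linarith
    obtain ⟨i, j, hij⟩ := H x f hinj fun i => (h.2 _ _).2 ⟨hxf i, hx i⟩
    obtain ⟨h0, h1, h2⟩ := (h.2 _ _).1 hij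
    rcases hne i j (fun e => h0 (by rw [e])) with h3 | h3 <;> linarith
  · intro H x f hf hx
    by_contra! hn
    obtain ⟨σ, hσ⟩ := exists_isClaw_of_disjoint h.1 f (fun i => ((h.2 _ _).1 (hx i)).2)
      (fun i j hij => by
        by_contra! hc
        exact hn i j ((h.2 _ _).2 ⟨hf.ne hij, hc.2, hc.1⟩))
    exact H x _ hσ

theorem IsIntervalRep.hasClawPartition_iff {V : Type*} {G : SimpleGraph V} {l r : V → ℝ}
    (h : IsIntervalRep G l r) {k v : ℕ} (hv : 1 ≤ v) :
    HasClawPartition G k v ↔ ∃ c : V → Fin k, ∀ (x : V) (f : Fin (v + 1) → V),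
      (∀ i, c (f i) = c x) → ¬ IsClaw l r x f := by
  refine exists_congr fun c => ?_
  simp only [(h.induce _).clawNumber_le_iff hv]
  constructor
  · intro H x f hc hf
    exact H (c x) ⟨x, rfl⟩ (fun i => ⟨f i, hc i⟩) hf
  · intro H i x f hf
    exact H x (fun j => f j) (fun j => (f j).2.trans x.2.symm) hf

theorem IsIntervalRep.card_le_of_clawNumber_le {V : Type*} {G : SimpleGraph V} {l r : V → ℝ}
    (h : IsIntervalRep G l r) {w : ℕ} (hw : 1 ≤ w) (hG : clawNumber G ≤ w) {x : V} {S : Finset V}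
    (hS : (S : Set V).Pairwise fun x y => r x ≤ l y ∨ r y ≤ l x)
    (hx : ∀ y ∈ S, l x < r y ∧ l y < r x) : S.card ≤ w := by
  by_contra! hc
  obtain ⟨f⟩ : Nonempty (Fin (w + 1) ↪ S) :=
    Function.Embedding.nonempty_of_card_le (by simpa using hc)
  obtain ⟨σ, hσ⟩ := exists_isClaw_of_disjoint h.1 (x := x) (fun i => (f i : V))
    (fun i => hx _ (f i).2)
    (fun i j hij => hS (f i).2 (f j).2 fun e => hij (f.injective (Subtype.ext e)))
  exact (h.clawNumber_le_iff hw).1 hG x _ hσ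

theorem HasClawPartition.mono {V : Type*} {G : SimpleGraph V} {l r : V → ℝ}
    (h : IsIntervalRep G l r) {k m v : ℕ} (hv : 1 ≤ v) (hkm : k ≤ m) (H : HasClawPartition G k v) :
    HasClawPartition G m v := by
  rw [h.hasClawPartition_iff hv] at H ⊢
  obtain ⟨c, hc⟩ := H
  exact ⟨fun x => Fin.castLE hkm (c x), fun x f hf => hc x f fun i => by simpa using hf i⟩

/-! ### The packing function -/

/-- The largest number of pairwise disjoint intervals that lie in `(-∞, t]`. -/
noncomputable def packing {V : Type*} (l r : V → ℝ) (t : ℝ) : ℕ :=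
  sSup {n | ∃ S : Finset V, (S : Set V).Pairwise (fun x y => r x ≤ l y ∨ r y ≤ l x) ∧
    (∀ x ∈ S, r x ≤ t) ∧ S.card = n}

section packing

variable {V : Type*} [Finite V] {l r : V → ℝ}

theorem card_le_packing {t : ℝ} {S : Finset V}
    (hS : (S : Set V).Pairwise fun x y => r x ≤ l y ∨ r y ≤ l x) (ht : ∀ x ∈ S, r x ≤ t) :
    S.card ≤ packing l r t := by
  have := Fintype.ofFinite V
  exact le_csSup ⟨Fintype.card V, by rintro _ ⟨S, -, -, rfl⟩; exact S.card_le_univ⟩ ⟨S, hS, ht, rfl⟩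

theorem exists_card_eq_packing (l r : V → ℝ) (t : ℝ) :
    ∃ S : Finset V, (S : Set V).Pairwise (fun x y => r x ≤ l y ∨ r y ≤ l x) ∧
      (∀ x ∈ S, r x ≤ t) ∧ S.card = packing l r t := by
  have := Fintype.ofFinite V
  exact Nat.sSup_mem (s := {n | ∃ S : Finset V,
    (S : Set V).Pairwise (fun x y => r x ≤ l y ∨ r y ≤ l x) ∧ (∀ x ∈ S, r x ≤ t) ∧ S.card = n})
    ⟨0, ∅, by simp, by simp, rfl⟩
    ⟨Fintype.card V, by rintro _ ⟨S, -, -, rfl⟩; exact S.card_le_univ⟩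

theorem packing_mono {s t : ℝ} (hst : s ≤ t) : packing l r s ≤ packing l r t := by
  obtain ⟨S, hS, hs, hc⟩ := exists_card_eq_packing l r s
  exact hc ▸ card_le_packing hS fun x hx => (hs x hx).trans hst

theorem packing_lt (hlr : ∀ x, l x < r x) (x : V) :
    packing l r (l x) < packing l r (r x) := by
  classical
  obtain ⟨S, hS, hs, hc⟩ := exists_card_eq_packing l r (l x)
  have hx : x ∉ S := fun hx => (hlr x).not_ge (hs x hx)
  rw [← hc, Nat.lt_iff_add_one_le, ← Finset.card_insert_of_notMem hx]
  refine card_le_packing ?_ ?_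
  · rw [Finset.coe_insert]
    refine hS.insert fun y hy _ => ⟨Or.inr (hs y hy), Or.inl (hs y hy)⟩
  · intro y hy
    rcases Finset.mem_insert.1 hy with rfl | hy
    · exact le_rfl
    · exact (hs y hy).trans (hlr x).le

/-- In a largest packing of `(-∞, r x]`, all intervals except the at most `packing l r (l x)` ones
that end before `x` starts meet `x`. -/
theorem IsIntervalRep.packing_right_le {G : SimpleGraph V} (h : IsIntervalRep G l r)
    {w : ℕ} (hw : 1 ≤ w) (hG : clawNumber G ≤ w) (x : V) :
    packing l r (r x) ≤ packing l r (l x) + w := by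
  classical
  obtain ⟨S, hS, hs, hc⟩ := exists_card_eq_packing l r (r x)
  rw [← hc, ← Finset.card_filter_add_card_filter_not (fun y => r y ≤ l x)]
  refine add_le_add (card_le_packing (hS.mono (Finset.coe_subset.2 (Finset.filter_subset _ _)))
    fun y hy => (Finset.mem_filter.1 hy).2) (h.card_le_of_clawNumber_le hw hG (x := x)
    (hS.mono (Finset.coe_subset.2 (Finset.filter_subset _ _))) fun y hy => ?_)
  obtain ⟨hy, hyx⟩ := Finset.mem_filter.1 hy
  exact ⟨not_le.1 hyx, (h.1 y).trans_le (hs y hy)⟩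

/-- If `y` meets `x`, then `y` can be added to the members of a largest packing of `(-∞, l y]` that
meet `x`. -/
theorem IsIntervalRep.packing_left_lt {G : SimpleGraph V} (h : IsIntervalRep G l r)
    {w : ℕ} (hw : 1 ≤ w) (hG : clawNumber G ≤ w) {x y : V} (hxy : l x < r y) (hyx : l y < r x) :
    packing l r (l y) + 1 ≤ packing l r (l x) + w := by
  classical
  obtain ⟨S, hS, hs, hc⟩ := exists_card_eq_packing l r (l y)
  rw [← hc, ← Finset.card_filter_add_card_filter_not (fun z => r z ≤ l x), add_assoc]
  have hy : y ∉ S.filter fun z => ¬ r z ≤ l x := fun hy =>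
    (h.1 y).not_ge (hs y (Finset.mem_filter.1 hy).1)
  rw [← Finset.card_insert_of_notMem hy]
  refine add_le_add (card_le_packing (hS.mono (Finset.coe_subset.2 (Finset.filter_subset _ _)))
    fun y hy => (Finset.mem_filter.1 hy).2) (h.card_le_of_clawNumber_le hw hG (x := x) ?_ ?_)
  · rw [Finset.coe_insert]
    refine (hS.mono (Finset.coe_subset.2 (Finset.filter_subset _ _))).insert fun z hz _ => ?_
    have := hs z (Finset.mem_filter.1 hz).1
    exact ⟨Or.inr this, Or.inl this⟩
  · intro z hz
    rcases Finset.mem_insert.1 hz with rfl | hz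
    · exact ⟨hxy, hyx⟩
    · obtain ⟨hz, hzx⟩ := Finset.mem_filter.1 hz
      exact ⟨not_le.1 hzx, ((h.1 z).trans_le (hs z hz)).trans hyx⟩

end packing

/-! ### Colourings by packing numbers -/

/-- A colouring that depends only on the packing numbers `a < b` of the two end points gives a
partition into classes of claw number at most `v` if it excludes all monochromatic configurations
of a centre `a, b` and leaves `p i, q i` which satisfy the inequalities valid for a claw in an
interval graph of claw number at most `w`. -/
theorem hasClawPartition_of_coloring {w v k : ℕ} (hw : 1 ≤ w) (hv : 1 ≤ v) (col : ℕ → ℕ → Fin k)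
    (hcol : ∀ (a b : ℕ) (p q : Fin (v + 1) → ℕ), a < b → b ≤ a + w →
      (∀ i, p i < q i ∧ q i ≤ p i + w ∧ p i ≤ b ∧ a ≤ q i ∧ p i + 1 ≤ a + w ∧ a + 1 ≤ p i + w) →
      (∀ i j, i < j → q i ≤ p j ∧ a ≤ p j ∧ q i ≤ b) → ∃ i, col (p i) (q i) ≠ col a b)
    (V : Type) [Finite V] (G : SimpleGraph V) (hG : IsIntervalGraph G) (hGw : clawNumber G ≤ w) :
    HasClawPartition G k v := by
  obtain ⟨l, r, h⟩ := isIntervalGraph_iff.1 hG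
  refine (h.hasClawPartition_iff hv).2
    ⟨fun x => col (packing l r (l x)) (packing l r (r x)), fun x f hc ⟨hx, hf⟩ => ?_⟩
  obtain ⟨i, hi⟩ := hcol (packing l r (l x)) (packing l r (r x)) (fun i => packing l r (l (f i)))
    (fun i => packing l r (r (f i))) (packing_lt h.1 x) (h.packing_right_le hw hGw x)
    (fun i => ⟨packing_lt h.1 _, h.packing_right_le hw hGw _, packing_mono (hx i).2.le,
      packing_mono (hx i).1.le, h.packing_left_lt hw hGw (hx i).1 (hx i).2,
      h.packing_left_lt hw hGw (hx i).2 (hx i).1⟩)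
    (fun i j hij => ⟨packing_mono (hf i j hij),
      packing_mono ((hx i).1.le.trans (hf i j hij)),
      packing_mono ((hf i j hij).trans (hx j).2.le)⟩)
  exact hi (hc i)

/-- The colour is the packing number of the left end point modulo `k`. For intervals that meet,
these numbers differ by less than `k`, so they agree within a colour class; but disjoint intervals
have different ones. -/
theorem hasClawPartition_one {k : ℕ} (hk : 1 ≤ k) (V : Type) [Finite V] (G : SimpleGraph V)
    (hG : IsIntervalGraph G) (hGw : clawNumber G ≤ k) : HasClawPartition G k 1 := by
  refine hasClawPartition_of_coloring hk le_rfl (fun a _ => ⟨a % k, Nat.mod_lt _ hk⟩) ?_ V G hG hGw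
  intro a b p q hab hb h1 h2
  by_contra! hc
  have h3 := h1 0
  have h4 := h1 1
  have h5 := h2 0 1 (by decide)
  have c0 : p 0 ≡ a [MOD k] := Fin.mk.inj_iff.1 (hc 0)
  have c1 : p 1 ≡ a [MOD k] := Fin.mk.inj_iff.1 (hc 1)
  have e1 : p 1 = a := by
    by_contra hne
    have := Nat.ModEq.add_le_of_lt c1.symm (by omega)
    omega
  have := Nat.ModEq.add_le_of_lt c0 (by omega)
  omega

/-- The colour alternates between blocks of two packing numbers of the left end point. No interval
reaches from one block to the next but one, and a single block has no three disjoint intervals. -/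
theorem hasClawPartition_two_two (V : Type) [Finite V] (G : SimpleGraph V)
    (hG : IsIntervalGraph G) (hGw : clawNumber G ≤ (3 : ℕ)) : HasClawPartition G 2 2 := by
  refine hasClawPartition_of_coloring (by norm_num) (by norm_num) (fun a _ => ⟨a / 2 % 2, by omega⟩)
    ?_ V G hG hGw
  intro a b p q hab hb h1 h2
  by_contra! hc
  have h10 := h1 0
  have h11 := h1 1
  have h12 := h1 2
  have h3 := h2 0 1 (by decide)
  have h4 := h2 1 2 (by decide)
  have c0 := Fin.mk.inj_iff.1 (hc 0)
  have c1 := Fin.mk.inj_iff.1 (hc 1)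
  have c2 := Fin.mk.inj_iff.1 (hc 2)
  omega

/-- The two classes are given by whether `{a, …, b - 1}` contains a multiple of `4`, where `a < b`
are the packing numbers of the end points. Without such multiples, a connected part lies between two
successive ones, and has no four disjoint intervals. With them, two inner leaves of a claw use up
two multiples in the set of the centre, which then has its largest size `5` and leaves no room for
the last leaf. -/
theorem hasClawPartition_two_three (V : Type) [Finite V] (G : SimpleGraph V)
    (hG : IsIntervalGraph G) (hGw : clawNumber G ≤ (5 : ℕ)) : HasClawPartition G 2 3 := by
  refine hasClawPartition_of_coloring (by norm_num) (by norm_num)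
    (fun a b => if (a + 3) / 4 = (b + 3) / 4 then 0 else 1) ?_ V G hG hGw
  intro a b p q hab hb h1 h2
  by_contra! hc
  have h10 := h1 0
  have h11 := h1 1
  have h12 := h1 2
  have h13 := h1 3
  have h3 := h2 0 1 (by decide)
  have h4 := h2 1 2 (by decide)
  have h5 := h2 2 3 (by decide)
  have c0 := hc 0
  have c1 := hc 1
  have c2 := hc 2
  have c3 := hc 3
  clear h1 h2 hc
  by_cases hx : (a + 3) / 4 = (b + 3) / 4
  · simp only [hx, if_true, ite_eq_left_iff, one_ne_zero, imp_false, not_not] at c0 c1 c2 c3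
    omega
  · simp only [hx, if_false, ite_eq_right_iff, zero_ne_one, imp_false] at c0 c1 c2 c3
    omega

/-- The three classes are given by whether `{a, …, b - 1}` contains a multiple of `9`, or else a
multiple of `3`, or none, where `a < b` are the packing numbers of the end points. In the latter two
classes a connected part has no three disjoint intervals. In the first class, the leaves of a claw
would contain three different multiples of `9`, but the centre and the two outer leaves are too
short to cover this distance. -/
theorem hasClawPartition_three_two (V : Type) [Finite V] (G : SimpleGraph V)
    (hG : IsIntervalGraph G) (hGw : clawNumber G ≤ (6 : ℕ)) : HasClawPartition G 3 2 := by
  refine hasClawPartition_of_coloring (by norm_num) (by norm_num)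
    (fun a b => if (a + 8) / 9 = (b + 8) / 9 then (if (a + 2) / 3 = (b + 2) / 3 then 0 else 1)
      else 2) ?_ V G hG hGw
  intro a b p q hab hb h1 h2
  by_contra! hc
  have h10 := h1 0
  have h11 := h1 1
  have h12 := h1 2
  have h3 := h2 0 1 (by decide)
  have h4 := h2 1 2 (by decide)
  have c0 := hc 0
  have c1 := hc 1
  have c2 := hc 2
  clear h1 h2 hc
  by_cases hx : (a + 8) / 9 = (b + 8) / 9
  · by_cases hy : (a + 2) / 3 = (b + 2) / 3
    · simp only [hx, hy, if_true] at c0 c1 c2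
      split_ifs at c0 c1 c2 <;> omega
    · simp only [hx, hy, if_true, if_false] at c0 c1 c2
      split_ifs at c0 c1 c2 <;> omega
  · simp only [hx, if_false] at c0 c1 c2
    split_ifs at c0 c1 c2 <;> omega

/-! ### Integer intervals -/

/-- The intersection graph of the open intervals `(l i, r i)`, `i < n`, with natural end points. -/
def natIntervalGraph (l r : ℕ → ℕ) (n : ℕ) : SimpleGraph (Fin n) where
  Adj x y := x ≠ y ∧ l x < r y ∧ l y < r x
  symm := ⟨fun _ _ h => ⟨h.1.symm, h.2.2, h.2.1⟩⟩
  loopless := ⟨fun _ h => h.1 rfl⟩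

section natIntervalGraph

variable {l r : ℕ → ℕ} {n : ℕ}

theorem isIntervalRep_natIntervalGraph (h : ∀ i < n, l i < r i) :
    IsIntervalRep (natIntervalGraph l r n) (fun i => (l i : ℝ)) (fun i => (r i : ℝ)) :=
  ⟨fun i => Nat.cast_lt.2 (h i i.2), fun x y => by simp [natIntervalGraph]⟩

theorem isIntervalGraph_natIntervalGraph (h : ∀ i < n, l i < r i) :
    IsIntervalGraph (natIntervalGraph l r n) :=
  isIntervalGraph_iff.2 ⟨_, _, isIntervalRep_natIntervalGraph h⟩

/-- If `u + 2` disjoint intervals meet an interval, then `u` of them lie inside it and the two outer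
ones overlap it by at least `1` each. -/
theorem clawNumber_natIntervalGraph_le {s u : ℕ} (hs : 1 ≤ s)
    (h : ∀ i < n, l i + s ≤ r i ∧ r i ≤ l i + u * s + 1) :
    clawNumber (natIntervalGraph l r n) ≤ (u + 1 : ℕ) := by
  rw [(isIntervalRep_natIntervalGraph fun i hi => by have := h i hi; omega).clawNumber_le_iff
    (by omega)]
  rintro x f ⟨hx, hf⟩
  simp only [Nat.cast_lt, Nat.cast_le] at hx hf
  -- the leaves between `f 0` and `f (i + 1)` fill a gap of length at least `i * s`
  have key : ∀ i (hi : i + 1 < u + 1 + 1), r (f 0) + i * s ≤ l (f ⟨i + 1, hi⟩) := by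
    intro i
    induction i with
    | zero => intro hi; simpa using hf 0 ⟨1, hi⟩ (by simp)
    | succ i ih =>
      intro hi
      have h1 := ih (by omega)
      have h2 := hf ⟨i + 1, by omega⟩ ⟨i + 1 + 1, hi⟩ (by simp [Fin.lt_def])
      have h3 := (h _ (f ⟨i + 1, by omega⟩).2).1
      rw [add_mul]
      omega
  have h1 := key u (by omega)
  have h2 := hx 0
  have h3 := hx ⟨u + 1, by omega⟩
  have h4 := h x x.2
  omega

end natIntervalGraph

/-! ### Exhaustive search for a 2-colouring -/

/-- The chains of `k` pairwise disjoint intervals with indices in `N` and to the right of `t`, each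
encoded as the number whose binary digits mark the indices of its members. -/
def chainMasks (l r : ℕ → ℕ) (N : List ℕ) : ℕ → ℕ → List ℕ
  | 0, _ => [0]
  | k + 1, t => N.flatMap fun y =>
      if t ≤ l y then (chainMasks l r N k (r y)).map (2 ^ y ||| ·) else []

/-- The claws with `v + 1` leaves among the intervals `(l i, r i)`, `i < n`, encoded in binary. -/
def clawMasks (l r : ℕ → ℕ) (n v : ℕ) : List ℕ :=
  (List.range n).flatMap fun x =>
    (chainMasks l r ((List.range n).filter fun y => l x < r y ∧ l y < r x) (v + 1) 0).map
      (2 ^ x ||| ·)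

/-- The claws, sorted by their member of largest index: this is the moment at which the search below
can first see them completely coloured. -/
def clawSteps (l r : ℕ → ℕ) (n v : ℕ) : List (List ℕ) :=
  (List.range n).map fun d => (clawMasks l r n v).filter fun m => Nat.beq m.log2 d

/-- Backtracking search. The binary digits of `R` and `B` mark the indices coloured so far, `b` is
the power of two of the next index, and the entries of `steps` list the sets that may not become
monochromatic at the respective step. If the result is `true`, then no colouring of all indices
extends the given one (`exists_mono_of_refuted`). Written with `Nat.land`, `Nat.lor` and `Nat.beq` in place of the
overloaded operations, which the kernel would have to unfold at every node of the search. -/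
def refuted : List (List ℕ) → ℕ → ℕ → ℕ → Bool
  | [], _, _, _ => false
  | ms :: rest, b, R, B =>
    (ms.any (fun m => Nat.beq (Nat.land m (Nat.lor R b)) m) ||
      refuted rest (2 * b) (Nat.lor R b) B) &&
    (ms.any (fun m => Nat.beq (Nat.land m (Nat.lor B b)) m) ||
      refuted rest (2 * b) R (Nat.lor B b))

/-- `m` is a set of indices, given by its binary digits, on which `c` has the constant value `a`. -/
def IsMono (c : ℕ → Bool) (a : Bool) (m : ℕ) : Prop :=
  ∀ i, m.testBit i = true → c i = a

theorem IsMono.or {c : ℕ → Bool} {a : Bool} {m m' : ℕ} :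
    IsMono c a (m ||| m') ↔ IsMono c a m ∧ IsMono c a m' := by
  simp only [IsMono, Nat.testBit_or, Bool.or_eq_true]
  exact ⟨fun h => ⟨fun i hi => h i (Or.inl hi), fun i hi => h i (Or.inr hi)⟩,
    fun h i hi => hi.elim (h.1 i) (h.2 i)⟩

theorem isMono_two_pow {c : ℕ → Bool} {a : Bool} {i : ℕ} : IsMono c a (2 ^ i) ↔ c i = a := by
  simp [IsMono, Nat.testBit_two_pow]

theorem exists_mono_of_any {c : ℕ → Bool} {a : Bool} {ms : List ℕ} {R : ℕ}
    (h : ms.any (fun m => Nat.beq (Nat.land m R) m) = true) (hR : IsMono c a R) :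
    ∃ m ∈ ms, IsMono c a m := by
  obtain ⟨m, hm, hmR⟩ := List.any_eq_true.1 h
  refine ⟨m, hm, fun i hi => hR i ?_⟩
  have hmR' : m &&& R = m := Nat.eq_of_beq_eq_true hmR
  rw [← hmR', Nat.testBit_and, Bool.and_eq_true] at hi
  exact hi.2

theorem exists_mono_of_refuted (c : ℕ → Bool) (steps : List (List ℕ)) (d R B : ℕ)
    (h : refuted steps (2 ^ d) R B = true) (hR : IsMono c true R) (hB : IsMono c false B) :
    ∃ ms ∈ steps, ∃ m ∈ ms, ∃ a, IsMono c a m := by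
  induction steps generalizing d R B with
  | nil => simp [refuted] at h
  | cons ms rest ih =>
    simp only [refuted, Bool.and_eq_true, Bool.or_eq_true, ← pow_succ'] at h
    have extend : (∃ ns ∈ rest, ∃ m ∈ ns, ∃ a, IsMono c a m) →
        ∃ ns ∈ ms :: rest, ∃ m ∈ ns, ∃ a, IsMono c a m := fun ⟨ns, hns, H⟩ =>
      ⟨ns, List.mem_cons_of_mem _ hns, H⟩
    cases hc : c d with
    | true =>
      have hR' : IsMono c true (R ||| 2 ^ d) := IsMono.or.2 ⟨hR, isMono_two_pow.2 hc⟩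
      rcases h.1 with h1 | h1
      · obtain ⟨m, hm, H⟩ := exists_mono_of_any h1 hR'
        exact ⟨ms, List.mem_cons_self, m, hm, _, H⟩
      · exact extend (ih _ _ _ h1 hR' hB)
    | false =>
      have hB' : IsMono c false (B ||| 2 ^ d) := IsMono.or.2 ⟨hB, isMono_two_pow.2 hc⟩
      rcases h.2 with h1 | h1
      · obtain ⟨m, hm, H⟩ := exists_mono_of_any h1 hB'
        exact ⟨ms, List.mem_cons_self, m, hm, _, H⟩
      · exact extend (ih _ _ _ h1 hR hB')

theorem exists_chain_of_mem_chainMasks {l r : ℕ → ℕ} {N : List ℕ} (hN : ∀ y ∈ N, l y ≤ r y)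
    {c : ℕ → Bool} {a : Bool} {k t m : ℕ} (hm : m ∈ chainMasks l r N k t) (hc : IsMono c a m) :
    ∃ f : Fin k → ℕ, (∀ i, f i ∈ N ∧ c (f i) = a ∧ t ≤ l (f i)) ∧
      ∀ i j, i < j → r (f i) ≤ l (f j) := by
  induction k generalizing t m with
  | zero => exact ⟨Fin.elim0, fun i => i.elim0, fun i => i.elim0⟩
  | succ k ih =>
    simp only [chainMasks, List.mem_flatMap] at hm
    obtain ⟨y, hy, hm⟩ := hm
    split_ifs at hm with ht
    · obtain ⟨m', hm', rfl⟩ := List.mem_map.1 hm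
      obtain ⟨hcy, hc'⟩ := IsMono.or.1 hc
      obtain ⟨f, hf, hf'⟩ := ih hm' hc'
      refine ⟨Fin.cons y f, fun i => ?_, fun i j hij => ?_⟩
      · cases i using Fin.cases with
        | zero => exact ⟨hy, isMono_two_pow.1 hcy, ht⟩
        | succ i => exact ⟨(hf i).1, (hf i).2.1, ht.trans ((hN y hy).trans (hf i).2.2)⟩
      · cases j using Fin.cases with
        | zero => exact absurd hij (Fin.not_lt_zero i)
        | succ j =>
          cases i using Fin.cases with
          | zero => exact (hf j).2.2
          | succ i => exact hf' i j (Fin.succ_lt_succ_iff.1 hij)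
    · simp at hm

/-- The colours can be exchanged, so the search may start with index `0` in the first class. -/
theorem not_hasClawPartition_of_refuted {l r : ℕ → ℕ} {n v : ℕ} (hv : 1 ≤ v)
    (hlr : ∀ i < n, l i < r i) (h : refuted (clawSteps l r n v).tail 2 1 0 = true) :
    ¬ HasClawPartition (natIntervalGraph l r n) 2 v := by
  rw [(isIntervalRep_natIntervalGraph hlr).hasClawPartition_iff hv]
  rintro ⟨c, hc⟩
  obtain ⟨c', hc', h0⟩ : ∃ c' : ℕ → Bool,
      (∀ i j : Fin n, c' i = c' j → c i = c j) ∧ c' 0 = true := by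
    let b : ℕ → Fin 2 := fun i => if hi : i < n then c ⟨i, hi⟩ else 0
    refine ⟨fun i => b i = b 0, fun i j hij => ?_, by simp⟩
    have key : ∀ p q t : Fin 2, (p = t ↔ q = t) → p = q := by decide
    simpa [b] using key _ _ _ (decide_eq_decide.1 hij)
  have hB : IsMono c' false 0 := fun i hi => by simp at hi
  obtain ⟨ms, hms, m, hm, a, ha⟩ := exists_mono_of_refuted c' _ 1 1 0 h
    (isMono_two_pow (i := 0).2 h0) hB
  obtain ⟨d, -, rfl⟩ := List.mem_map.1 (List.mem_of_mem_tail hms)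
  obtain ⟨x, hx, hm⟩ := List.mem_flatMap.1 (List.mem_of_mem_filter hm)
  obtain ⟨m', hm', rfl⟩ := List.mem_map.1 hm
  obtain ⟨hax, ha⟩ := IsMono.or.1 ha
  rw [isMono_two_pow] at hax
  obtain ⟨f, hf, hf'⟩ := exists_chain_of_mem_chainMasks (fun y hy =>
    (hlr y (List.mem_range.1 (List.mem_of_mem_filter hy))).le) hm' ha
  have hfn : ∀ i, f i < n ∧ l x < r (f i) ∧ l (f i) < r x := fun i => by
    simpa using (hf i).1
  refine hc ⟨x, List.mem_range.1 hx⟩ (fun i => ⟨f i, (hfn i).1⟩) (fun i => hc' _ _ ?_) ⟨?_, ?_⟩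
  · exact (hf i).2.1.trans hax.symm
  · exact fun i => ⟨Nat.cast_lt.2 (hfn i).2.1, Nat.cast_lt.2 (hfn i).2.2⟩
  · exact fun i j hij => Nat.cast_le.2 (hf' i j hij)

/-! ### Values of the partition number -/

theorem isKappaCheck_of {w v k : ℕ} (hv : 1 ≤ v)
    (upper : ∀ (V : Type) [Finite V] (G : SimpleGraph V),
      IsIntervalGraph G → clawNumber G ≤ w → HasClawPartition G (k + 1) v)
    {V : Type} [Finite V] {G : SimpleGraph V} (hG : IsIntervalGraph G) (hGw : clawNumber G ≤ w)
    (lower : ¬ HasClawPartition G k v) : IsKappaCheck w v (k + 1) := by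
  obtain ⟨l, r, h⟩ := isIntervalGraph_iff.1 hG
  refine ⟨fun V _ G => upper V G, fun m hm => ?_⟩
  by_contra! hmk
  exact lower ((hm V G hG hGw).mono h hv (Nat.lt_succ_iff.1 hmk))

/-- A lower bound of `2` needs only the star with `w` leaves, realised by the interval `(0, w)`
and the unit intervals inside it. -/
theorem isKappaCheck_two {w v : ℕ} (hv : 1 ≤ v) (hvw : v < w)
    (upper : ∀ (V : Type) [Finite V] (G : SimpleGraph V),
      IsIntervalGraph G → clawNumber G ≤ w → HasClawPartition G 2 v) : IsKappaCheck w v 2 := by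
  let l : ℕ → ℕ := fun i => i - 1
  let r : ℕ → ℕ := fun i => if i = 0 then w else i
  have hlr : ∀ i < w + 1, l i < r i := fun i _ => by simp only [l, r]; split_ifs <;> omega
  refine isKappaCheck_of hv upper (isIntervalGraph_natIntervalGraph (n := w + 1) hlr) ?_ ?_
  · obtain ⟨u, rfl⟩ : ∃ u, w = u + 1 := ⟨w - 1, by omega⟩
    refine clawNumber_natIntervalGraph_le le_rfl fun i _ => ?_
    simp only [l, r]
    split_ifs <;> omega
  · rw [(isIntervalRep_natIntervalGraph hlr).hasClawPartition_iff hv]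
    rintro ⟨c, hc⟩
    refine hc 0 (fun i => ⟨i + 1, by omega⟩) (fun i => Subsingleton.elim _ _)
      ⟨fun i => ?_, fun i j hij => ?_⟩
    · simp only [l, r, Nat.cast_lt, Fin.val_zero]
      have := i.2
      constructor <;> simp
      omega
    · simp only [l, r, Nat.cast_le]
      have := Fin.lt_def.1 hij
      simp
      omega

/-- Nine intervals of lengths `1`, `2` and `3`. -/
def nineIntervals : List (ℕ × ℕ) :=
  [(0, 1), (0, 2), (0, 3), (1, 2), (2, 3), (2, 5), (3, 4), (3, 5), (4, 5)]

/-- Intervals of lengths between `2` and `7`. The order, which is the one of the search, has been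
optimised: it keeps the search tree small. -/
def thirtyNineIntervals : List (ℕ × ℕ) :=
  [(16, 18), (9, 16), (18, 20), (14, 21), (20, 27), (15, 22), (21, 23), (19, 21), (23, 26),
   (17, 24), (17, 19), (15, 17), (13, 15), (12, 19), (6, 13), (11, 18), (18, 25), (10, 12), (3, 10),
   (12, 14), (14, 16), (8, 15), (14, 18), (7, 9), (0, 7), (9, 11), (11, 13), (5, 12), (11, 15),
   (4, 6), (0, 4), (6, 8), (8, 10), (9, 13), (14, 19), (11, 16), (2, 9), (16, 21), (10, 17)]

theorem isKappaCheck_three_one : IsKappaCheck 3 1 3 := by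
  let l : ℕ → ℕ := fun i => (nineIntervals.getD i (0, 0)).1
  let r : ℕ → ℕ := fun i => (nineIntervals.getD i (0, 0)).2
  have hlen : ∀ i < 9, l i + 1 ≤ r i ∧ r i ≤ l i + 2 * 1 + 1 := by decide +kernel
  have hlr : ∀ i < 9, l i < r i := fun i hi => by have := hlen i hi; omega
  exact isKappaCheck_of le_rfl (fun V _ G => hasClawPartition_one (by norm_num) V G)
    (isIntervalGraph_natIntervalGraph hlr) (clawNumber_natIntervalGraph_le le_rfl hlen)
    (not_hasClawPartition_of_refuted le_rfl hlr (by decide +kernel))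

/-- The same graph serves for `w = 4, 5, 6`: it has claw number at most `4`. -/
theorem isKappaCheck_two_three {w : ℕ} (h4 : 4 ≤ w) (h6 : w ≤ 6) : IsKappaCheck w 2 3 := by
  let l : ℕ → ℕ := fun i => (thirtyNineIntervals.getD i (0, 0)).1
  let r : ℕ → ℕ := fun i => (thirtyNineIntervals.getD i (0, 0)).2
  have hlen : ∀ i < 39, l i + 2 ≤ r i ∧ r i ≤ l i + 3 * 2 + 1 := by decide +kernel
  have hlr : ∀ i < 39, l i < r i := fun i hi => by have := hlen i hi; omega
  exact isKappaCheck_of one_le_two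
    (fun V _ G hG hGw => hasClawPartition_three_two V G hG (hGw.trans (by exact_mod_cast h6)))
    (isIntervalGraph_natIntervalGraph hlr)
    ((clawNumber_natIntervalGraph_le one_le_two hlen).trans (by exact_mod_cast h4))
    (not_hasClawPartition_of_refuted one_le_two hlr (by decide +kernel))

theorem theorem5 :
    IsKappaCheck 2 1 2 ∧ IsKappaCheck 3 1 3 ∧
    IsKappaCheck 3 2 2 ∧
    IsKappaCheck 4 2 3 ∧ IsKappaCheck 5 2 3 ∧ IsKappaCheck 6 2 3 ∧
    IsKappaCheck 5 3 2 :=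
  ⟨isKappaCheck_two (by norm_num) (by norm_num)
      fun V _ G => hasClawPartition_one (by norm_num) V G,
    isKappaCheck_three_one,
    isKappaCheck_two (by norm_num) (by norm_num) hasClawPartition_two_two,
    isKappaCheck_two_three (by norm_num) (by norm_num),
    isKappaCheck_two_three (by norm_num) (by norm_num),
    isKappaCheck_two_three (by norm_num) (by norm_num),
    isKappaCheck_two (by norm_num) (by norm_num) hasClawPartition_two_three⟩
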